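/- Let $\mathcal H,\mathcal G_1,\mathcal G_2$ be (real or complex) Hilbert spaces and let $H_0\colon D(H_0)\subseteq\mathcal H\to\mathcal H$ be a densely defined, closed, skew-symmetric linear operator, i.e. $H_0\subseteq -H_0^\star$. An operator $H$ in $\mathcal H$ is called skew-self-adjoint if it is densely defined and $H=-H^\star$. Let $(\Omega,\mathcal G_1,\mathcal G_2,F,\omega)$ be a boundary system for $H_0$ with the standard forms, that is, $F\colon\operatorname{Graph}(H_0^\star)\to\mathcal G_1\oplus\mathcal G_2$ is a surjective map with $$\Omega\bigl((x,H_0^\star x),(y,H_0^\star y)\bigr)=\omega\bigl(F(x,H_0^\star x),F(y,H_0^\star y)\bigr)\qquad(x,y\in D(H_0^\star)),$$ where $\Omega((x,y),(u,v))=(x,v)_{\mathcal H}+(y,u)_{\mathcal H}$ is the standard symmetric form on $\mathcal H\oplus\mathcal H$ and $\omega((x,y),(u,v))=(x,u)_{\mathcal G_1}-(y,v)_{\mathcal G_2}$ is the standard unitary form on $\mathcal G_1\oplus\mathcal G_2$. Write $F(x,H_0^\star x)=(F_1x,F_2x)$ for $x\in D(H_0^\star)$, and let $U(\mathcal G,\mathcal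 G')$ denote the set of unitary operators from $\mathcal G$ onto $\mathcal G'$, with $U(\mathcal G)=U(\mathcal G,\mathcal G)$. Fix $L_0\in U(\mathcal G_1,\mathcal G_2)$ and set $$\Gamma_1x=\tfrac1{\sqrt2}\bigl(F_1x+L_0^{-1}F_2x\bigr),\qquad \Gamma_2x=\tfrac1{\sqrt2}\bigl(F_1x-L_0^{-1}F_2x\bigr)\qquad(x\in D(H_0^\star)=D(-H_0^\star)).$$ Then the following hold. 1. $(\mathcal G_1,\Gamma_1,\Gamma_2)$ is a boundary triplet for $H_0$: the maps $\Gamma_1,\Gamma_2\colon D(-H_0^\star)\to\mathcal G_1$ are linear, $x\mapsto(\Gamma_1x,\Gamma_2x)$ maps $D(-H_0^\star)$ onto $\mathcal G_1\oplus\mathcal G_1$, and $(H_0^\star x,y)_{\mathcal H}+(x,H_0^\star y)_{\mathcal H}=(\Gamma_1x,\Gamma_2y)_{\mathcal G_1}+(\Gamma_2x,\Gamma_1y)_{\mathcal G_1}$ for all $x,y\in D(-H_0^\star)$. 2. The map $\Psi$ given by $$\Psi(L)=-H_0^\star|_{D(\Psi(L))},\qquad D(\Psi(L))=\{x\in D(-H_0^\star)\;:\;(L-1)\Gamma_1x+(L+1)\Gamma_2x=0\},$$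 is a bijection from $U(\mathcal G_1)$ onto the set of all skew-self-adjoint operators $H$ with $H_0\subseteq H$. 3. The map $\bar\Psi$ given by $$\bar\Psi(L)=H_0^\star|_{D(\bar\Psi(L))},\qquad D(\bar\Psi(L))=\{x\in D(H_0^\star)\;:\;LF_1x=F_2x\},$$ is a bijection from $U(\mathcal G_1,\mathcal G_2)$ onto the set of all skew-self-adjoint operators $H$ with $H\subseteq H_0^\star$. 4. $\bar\Psi(L)=-\Psi(L_0^{-1}L)$ for every $L\in U(\mathcal G_1,\mathcal G_2)$. -/

import Mathlib

open scoped LinearPMap ComplexConjugate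

noncomputable section

namespace BoundaryExtension

/-- `H` is skew-symmetric: `H ⊆ -H⋆` (used only for densely defined `H`). -/
def IsSkewSymmetric {𝕜 H : Type*} [RCLike 𝕜] [NormedAddCommGroup H] [InnerProductSpace 𝕜 H]
    [CompleteSpace H] (T : H →ₗ.[𝕜] H) : Prop :=
  T ≤ -T†

/-- `H` is skew-self-adjoint: it is densely defined and `H = -H⋆`. -/
def IsSkewSelfAdjoint {𝕜 H : Type*} [RCLike 𝕜] [NormedAddCommGroup H] [InnerProductSpace 𝕜 H]
    [CompleteSpace H] (T : H →ₗ.[𝕜] H) : Prop :=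
  Dense (T.domain : Set H) ∧ T = -T†

/-- The standard symmetric form `Ω((x,y),(u,v)) = (x,v) + (y,u)` on `H ⊕ H`. As for Mathlib's inner
product, sesquilinear forms are conjugate-linear in the first argument and linear in the second. -/
def standardSymmetricForm (𝕜 H : Type*) [RCLike 𝕜] [NormedAddCommGroup H]
    [InnerProductSpace 𝕜 H] : (H × H) →ₗ⋆[𝕜] (H × H) →ₗ[𝕜] 𝕜 :=
  LinearMap.mk₂'ₛₗ (starRingEnd 𝕜) (RingHom.id 𝕜)
    (fun p q => inner 𝕜 p.1 q.2 + inner 𝕜 p.2 q.1)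
    (by intro p p' q; simp only [Prod.fst_add, Prod.snd_add, inner_add_left]; ring)
    (by intro c p q; simp only [Prod.smul_fst, Prod.smul_snd, inner_smul_left, smul_eq_mul]; ring)
    (by intro p q q'; simp only [Prod.fst_add, Prod.snd_add, inner_add_right]; ring)
    (by intro c p q
        simp only [Prod.smul_fst, Prod.smul_snd, inner_smul_right, smul_eq_mul, RingHom.id_apply]
        ring)

/-- The standard unitary form `ω((x,y),(u,v)) = (x,u) - (y,v)` on `G₁ ⊕ G₂`. -/
def standardUnitaryForm (𝕜 G₁ G₂ : Type*) [RCLike 𝕜] [NormedAddCommGroup G₁]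
    [InnerProductSpace 𝕜 G₁] [NormedAddCommGroup G₂] [InnerProductSpace 𝕜 G₂] :
    (G₁ × G₂) →ₗ⋆[𝕜] (G₁ × G₂) →ₗ[𝕜] 𝕜 :=
  LinearMap.mk₂'ₛₗ (starRingEnd 𝕜) (RingHom.id 𝕜)
    (fun p q => inner 𝕜 p.1 q.1 - inner 𝕜 p.2 q.2)
    (by intro p p' q; simp only [Prod.fst_add, Prod.snd_add, inner_add_left]; ring)
    (by intro c p q; simp only [Prod.smul_fst, Prod.smul_snd, inner_smul_left, smul_eq_mul]; ring)
    (by intro p q q'; simp only [Prod.fst_add, Prod.snd_add, inner_add_right]; ring)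
    (by intro c p q
        simp only [Prod.smul_fst, Prod.smul_snd, inner_smul_right, smul_eq_mul, RingHom.id_apply]
        ring)

/-- `(Ω, G₁, G₂, F, ω)` is a boundary system for `H₀`. The map `F` is only required to be
surjective; it is not assumed to be linear. -/
structure IsBoundarySystem {𝕜 H G₁ G₂ : Type*} [RCLike 𝕜]
    [NormedAddCommGroup H] [InnerProductSpace 𝕜 H] [CompleteSpace H]
    [NormedAddCommGroup G₁] [InnerProductSpace 𝕜 G₁]
    [NormedAddCommGroup G₂] [InnerProductSpace 𝕜 G₂]
    (H₀ : H →ₗ.[𝕜] H) (Ω : (H × H) →ₗ⋆[𝕜] (H × H) →ₗ[𝕜] 𝕜)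
    (F : H₀†.graph → G₁ × G₂) (ω : (G₁ × G₂) →ₗ⋆[𝕜] (G₁ × G₂) →ₗ[𝕜] 𝕜) : Prop where
  surjective : Function.Surjective F
  form_eq : ∀ p q : H₀†.graph, Ω (p : H × H) (q : H × H) = ω (F p) (F q)

/-- `(G, Γ₁, Γ₂)` is a boundary triplet for `H₀`. Note `D(-H₀⋆) = D(H₀⋆)`. -/
structure IsBoundaryTriplet {𝕜 H G : Type*} [RCLike 𝕜]
    [NormedAddCommGroup H] [InnerProductSpace 𝕜 H] [CompleteSpace H]
    [NormedAddCommGroup G] [InnerProductSpace 𝕜 G]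
    (H₀ : H →ₗ.[𝕜] H) (Γ₁ Γ₂ : H₀†.domain →ₗ[𝕜] G) : Prop where
  surjective : Function.Surjective fun x => (Γ₁ x, Γ₂ x)
  green : ∀ x y : H₀†.domain,
    inner 𝕜 (H₀† x) (y : H) + inner 𝕜 (x : H) (H₀† y)
      = inner 𝕜 (Γ₁ x) (Γ₂ y) + inner 𝕜 (Γ₂ x) (Γ₁ y)

section Maps

variable {𝕜 H G₁ G₂ : Type*} [RCLike 𝕜]
  [NormedAddCommGroup H] [InnerProductSpace 𝕜 H] [CompleteSpace H]
  [NormedAddCommGroup G₁] [InnerProductSpace 𝕜 G₁]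
  [NormedAddCommGroup G₂] [InnerProductSpace 𝕜 G₂]
  {H₀ : H →ₗ.[𝕜] H}

/-- The point `(x, H₀⋆ x)` of the graph of `H₀⋆`. -/
def graphPoint (x : H₀†.domain) : H₀†.graph :=
  ⟨((x : H), H₀† x), LinearPMap.mem_graph _ x⟩

theorem standardUnitaryForm_separating (p p' : G₁ × G₂)
    (h : ∀ q, standardUnitaryForm 𝕜 G₁ G₂ q p = standardUnitaryForm 𝕜 G₁ G₂ q p') : p = p' := by
  have h1 : p.1 = p'.1 := ext_inner_left 𝕜 fun v => by
    simpa [standardUnitaryForm] using h (v, 0)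
  have h2 : p.2 = p'.2 := ext_inner_left 𝕜 fun v => by
    simpa [standardUnitaryForm] using h (0, v)
  exact Prod.ext h1 h2

/-- In a boundary system whose form on `G₁ ⊕ G₂` is the standard unitary form, the surjective map
`F` is automatically additive. -/
theorem IsBoundarySystem.map_add {Ω : (H × H) →ₗ⋆[𝕜] (H × H) →ₗ[𝕜] 𝕜} {F : H₀†.graph → G₁ × G₂}
    (h : IsBoundarySystem H₀ Ω F (standardUnitaryForm 𝕜 G₁ G₂)) (p q : H₀†.graph) :
    F (p + q) = F p + F q := by
  apply standardUnitaryForm_separating (𝕜 := 𝕜)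
  intro r
  obtain ⟨s, rfl⟩ := h.surjective r
  rw [_root_.map_add, ← h.form_eq, ← h.form_eq, ← h.form_eq, Submodule.coe_add, _root_.map_add]

/-- In a boundary system whose form on `G₁ ⊕ G₂` is the standard unitary form, the surjective map
`F` is automatically homogeneous. -/
theorem IsBoundarySystem.map_smul {Ω : (H × H) →ₗ⋆[𝕜] (H × H) →ₗ[𝕜] 𝕜} {F : H₀†.graph → G₁ × G₂}
    (h : IsBoundarySystem H₀ Ω F (standardUnitaryForm 𝕜 G₁ G₂)) (c : 𝕜) (p : H₀†.graph) :
    F (c • p) = c • F p := by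
  apply standardUnitaryForm_separating (𝕜 := 𝕜)
  intro r
  obtain ⟨s, rfl⟩ := h.surjective r
  rw [_root_.map_smul, ← h.form_eq, ← h.form_eq, Submodule.coe_smul, _root_.map_smul]

theorem graphPoint_add (x y : H₀†.domain) :
    graphPoint (x + y) = graphPoint x + graphPoint y :=
  Subtype.ext (Prod.ext rfl (H₀†.map_add x y))

theorem graphPoint_smul (c : 𝕜) (x : H₀†.domain) :
    graphPoint (c • x) = c • graphPoint x :=
  Subtype.ext (Prod.ext rfl (H₀†.map_smul c x))

/-- `F₁ x = pr₁ (F (x, H₀⋆ x))`. -/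
def IsBoundarySystem.F₁ {Ω : (H × H) →ₗ⋆[𝕜] (H × H) →ₗ[𝕜] 𝕜} {F : H₀†.graph → G₁ × G₂}
    (h : IsBoundarySystem H₀ Ω F (standardUnitaryForm 𝕜 G₁ G₂)) : H₀†.domain →ₗ[𝕜] G₁ where
  toFun x := (F (graphPoint x)).1
  map_add' x y := by rw [graphPoint_add, h.map_add, Prod.fst_add]
  map_smul' c x := by rw [graphPoint_smul, h.map_smul, Prod.smul_fst, RingHom.id_apply]

/-- `F₂ x = pr₂ (F (x, H₀⋆ x))`. -/
def IsBoundarySystem.F₂ {Ω : (H × H) →ₗ⋆[𝕜] (H × H) →ₗ[𝕜] 𝕜} {F : H₀†.graph → G₁ × G₂}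
    (h : IsBoundarySystem H₀ Ω F (standardUnitaryForm 𝕜 G₁ G₂)) : H₀†.domain →ₗ[𝕜] G₂ where
  toFun x := (F (graphPoint x)).2
  map_add' x y := by rw [graphPoint_add, h.map_add, Prod.snd_add]
  map_smul' c x := by rw [graphPoint_smul, h.map_smul, Prod.smul_snd, RingHom.id_apply]

/-- `Γ₁ x = (F₁ x + L₀⁻¹ F₂ x) / √2`. -/
def IsBoundarySystem.Γ₁ {Ω : (H × H) →ₗ⋆[𝕜] (H × H) →ₗ[𝕜] 𝕜} {F : H₀†.graph → G₁ × G₂}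
    (h : IsBoundarySystem H₀ Ω F (standardUnitaryForm 𝕜 G₁ G₂)) (L₀ : G₁ ≃ₗᵢ[𝕜] G₂) :
    H₀†.domain →ₗ[𝕜] G₁ :=
  ((Real.sqrt 2 : ℝ) : 𝕜)⁻¹ • (h.F₁ + L₀.symm.toLinearEquiv.toLinearMap ∘ₗ h.F₂)

/-- `Γ₂ x = (F₁ x - L₀⁻¹ F₂ x) / √2`. -/
def IsBoundarySystem.Γ₂ {Ω : (H × H) →ₗ⋆[𝕜] (H × H) →ₗ[𝕜] 𝕜} {F : H₀†.graph → G₁ × G₂}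
    (h : IsBoundarySystem H₀ Ω F (standardUnitaryForm 𝕜 G₁ G₂)) (L₀ : G₁ ≃ₗᵢ[𝕜] G₂) :
    H₀†.domain →ₗ[𝕜] G₁ :=
  ((Real.sqrt 2 : ℝ) : 𝕜)⁻¹ • (h.F₁ - L₀.symm.toLinearEquiv.toLinearMap ∘ₗ h.F₂)

/-- The operator `H₀⋆` restricted to `{x ∈ D(H₀⋆) ; L F₁ x = F₂ x}`. -/
def schubertMap (F₁ : H₀†.domain →ₗ[𝕜] G₁) (F₂ : H₀†.domain →ₗ[𝕜] G₂) (L : G₁ ≃ₗᵢ[𝕜] G₂) :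
    H →ₗ.[𝕜] H :=
  H₀†.domRestrict
    { carrier := {x | ∃ hx : x ∈ H₀†.domain, L (F₁ ⟨x, hx⟩) = F₂ ⟨x, hx⟩}
      zero_mem' := ⟨Submodule.zero_mem _, by
        rw [show (⟨0, Submodule.zero_mem _⟩ : H₀†.domain) = 0 from rfl]; simp⟩
      add_mem' := by
        rintro x y ⟨hx, hx'⟩ ⟨hy, hy'⟩
        refine ⟨Submodule.add_mem _ hx hy, ?_⟩
        rw [show (⟨x + y, Submodule.add_mem _ hx hy⟩ : H₀†.domain) = ⟨x, hx⟩ + ⟨y, hy⟩ from rfl]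
        simp only [_root_.map_add, hx', hy']
      smul_mem' := by
        rintro c x ⟨hx, hx'⟩
        refine ⟨Submodule.smul_mem _ c hx, ?_⟩
        rw [show (⟨c • x, Submodule.smul_mem _ c hx⟩ : H₀†.domain) = c • ⟨x, hx⟩ from rfl]
        simp only [_root_.map_smul, hx'] }

/-- The operator `-H₀⋆` restricted to
`{x ∈ D(-H₀⋆) ; (L - 1) Γ₁ x + (L + 1) Γ₂ x = 0}`. -/
def gorbachukMap (Γ₁ Γ₂ : H₀†.domain →ₗ[𝕜] G₁) (L : G₁ ≃ₗᵢ[𝕜] G₁) : H →ₗ.[𝕜] H :=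
  (-H₀†).domRestrict
    { carrier := {x | ∃ hx : x ∈ H₀†.domain,
        (L (Γ₁ ⟨x, hx⟩) - Γ₁ ⟨x, hx⟩) + (L (Γ₂ ⟨x, hx⟩) + Γ₂ ⟨x, hx⟩) = 0}
      zero_mem' := ⟨Submodule.zero_mem _, by
        rw [show (⟨0, Submodule.zero_mem _⟩ : H₀†.domain) = 0 from rfl]; simp⟩
      add_mem' := by
        rintro x y ⟨hx, hx'⟩ ⟨hy, hy'⟩
        refine ⟨Submodule.add_mem _ hx hy, ?_⟩
        rw [show (⟨x + y, Submodule.add_mem _ hx hy⟩ : H₀†.domain) = ⟨x, hx⟩ + ⟨y, hy⟩ from rfl]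
        have := congrArg₂ (· + ·) hx' hy'
        simp only [_root_.map_add, add_zero] at this ⊢
        rw [← this]; abel
      smul_mem' := by
        rintro c x ⟨hx, hx'⟩
        refine ⟨Submodule.smul_mem _ c hx, ?_⟩
        rw [show (⟨c • x, Submodule.smul_mem _ c hx⟩ : H₀†.domain) = c • ⟨x, hx⟩ from rfl]
        simp only [_root_.map_smul, ← smul_sub, ← smul_add, hx', smul_zero] }

end Maps

end BoundaryExtension

end

/-!
Everything is read off from the form `⟪H₀† x, y⟫ + ⟪x, H₀† y⟫` on `D(H₀†)`, which `F₁` and `F₂`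
carry over to the indefinite form `⟪p.1, q.1⟫ - ⟪p.2, q.2⟫` on `G₁ × G₂`.

A restriction `T` of `H₀†` is skew-self-adjoint exactly when it extends `-H₀` and its domain is its
own orthogonal complement in `D(H₀†)` for the first form
(`isSkewSelfAdjoint_iff_of_le_adjoint`). Skew-symmetry of `H₀` says that `D(H₀)` is in the radical
of this form, hence in the kernel of `(F₁, F₂)`. So such domains correspond, by taking images
and preimages under the surjection `(F₁, F₂)`, to the subspaces of `G₁ × G₂` that are their own
orthogonal complement for the second form. These subspaces are precisely the graphs of the unitary
maps `G₁ → G₂` (`exists_linearIsometryEquiv_of_forall_mem_iff`): on such a subspace both coordinate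
projections are isometric, so their ranges are closed, and a vector orthogonal to a range gives an
element of the subspace with a vanishing coordinate, hence vanishes. This gives the bijection for
`schubertMap`.

Since `Γ₁ + Γ₂ = √2 F₁` and `Γ₁ - Γ₂ = √2 L₀⁻¹ F₂`, the boundary condition of `gorbachukMap` at
`L₀⁻¹ L` is that of `schubertMap` at `L`
(`IsBoundarySystem.schubertMap_eq_neg_gorbachukMap`). The bijection for `gorbachukMap` follows by
composing with `L ↦ L₀ L` and `T ↦ -T`.
-/

open scoped LinearPMap

/-! ### Adjoints of partially defined operators -/

namespace LinearPMap

theorem neg_le_neg_of_le {R E F : Type*} [Ring R] [AddCommGroup E] [Module R E] [AddCommGroup F]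
    [Module R F] {S T : E →ₗ.[R] F} (h : S ≤ T) : -S ≤ -T :=
  ⟨h.1, fun _ _ hxy => congrArg Neg.neg (h.2 hxy)⟩

theorem eq_of_le_of_forall_mem_domain_iff {R E F : Type*} [Ring R] [AddCommGroup E] [Module R E]
    [AddCommGroup F] [Module R F] {A S T : E →ₗ.[R] F} (hS : S ≤ A) (hT : T ≤ A)
    (h : ∀ x : A.domain, (x : E) ∈ S.domain ↔ (x : E) ∈ T.domain) : S = T := by
  refine LinearPMap.dExt (le_antisymm (fun x hx => (h ⟨x, hS.1 hx⟩).1 hx)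
    fun x hx => (h ⟨x, hT.1 hx⟩).2 hx) fun x y hxy => ?_
  rw [hS.2 (y := ⟨x, hS.1 x.2⟩) rfl, hT.2 (y := ⟨x, hS.1 x.2⟩) hxy.symm]

variable {𝕜 E : Type*} [RCLike 𝕜] [NormedAddCommGroup E] [InnerProductSpace 𝕜 E]
  [CompleteSpace E]

theorem adjoint_le_adjoint_of_le {S T : E →ₗ.[𝕜] E} (hS : Dense (S.domain : Set E)) (h : S ≤ T) :
    T† ≤ S† := by
  refine IsFormalAdjoint.le_adjoint hS fun x y => ?_
  rw [apply_comp_inclusion h x]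
  exact (adjoint_isFormalAdjoint (hS.mono h.1)).symm _ y

theorem le_adjoint_adjoint {T : E →ₗ.[𝕜] E} (hT : Dense (T.domain : Set E))
    (hT' : Dense (T†.domain : Set E)) : T ≤ T†† :=
  IsFormalAdjoint.le_adjoint hT' (adjoint_isFormalAdjoint hT)

theorem neg_adjoint_le_adjoint_neg {T : E →ₗ.[𝕜] E} (hT : Dense (T.domain : Set E)) :
    -T† ≤ (-T)† := by
  refine IsFormalAdjoint.le_adjoint (T := -T) hT fun x y => ?_
  rw [neg_apply, neg_apply, inner_neg_left, inner_neg_right]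
  exact congrArg Neg.neg ((adjoint_isFormalAdjoint hT).symm x y)

theorem adjoint_neg {T : E →ₗ.[𝕜] E} (hT : Dense (T.domain : Set E)) : (-T)† = -T† := by
  have h := neg_adjoint_le_adjoint_neg hT
  have h' := neg_le_neg_of_le (neg_adjoint_le_adjoint_neg (T := -T) hT)
  rw [neg_neg, neg_neg] at h'
  exact (eq_of_le_of_domain_eq h (le_antisymm h.1 h'.1)).symm

end LinearPMap

/-! ### Unitary graphs in a product of Hilbert spaces -/

/-- The range of an isometry between complete spaces is closed, so it is everything as soon as its
orthogonal complement is trivial. -/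
theorem LinearIsometry.surjective_of_forall_inner_eq_zero {𝕜 M G : Type*} [RCLike 𝕜]
    [NormedAddCommGroup M] [NormedSpace 𝕜 M] [CompleteSpace M]
    [NormedAddCommGroup G] [InnerProductSpace 𝕜 G] [CompleteSpace G] (f : M →ₗᵢ[𝕜] G)
    (h : ∀ g : G, (∀ x, inner 𝕜 (f x) g = 0) → g = 0) : Function.Surjective f := by
  have hc : IsClosed (f.toLinearMap.range : Set G) := by
    rw [LinearMap.coe_range]
    exact f.isometry.isClosedEmbedding.isClosed_range
  have : CompleteSpace f.toLinearMap.range := hc.completeSpace_coe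
  have hbot : f.toLinearMap.rangeᗮ = ⊥ := by
    rw [eq_bot_iff]
    intro g hg
    exact h g fun x => hg _ ⟨x, rfl⟩
  rw [Submodule.orthogonal_eq_bot_iff] at hbot
  exact LinearMap.range_eq_top.mp hbot

/-- A subspace of `G₁ × G₂` that is its own orthogonal complement for the form
`⟪p.1, q.1⟫ - ⟪p.2, q.2⟫` is the graph of a unitary map. -/
theorem exists_linearIsometryEquiv_of_forall_mem_iff {𝕜 G₁ G₂ : Type*} [RCLike 𝕜]
    [NormedAddCommGroup G₁] [InnerProductSpace 𝕜 G₁] [CompleteSpace G₁]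
    [NormedAddCommGroup G₂] [InnerProductSpace 𝕜 G₂] [CompleteSpace G₂]
    (M : Submodule 𝕜 (G₁ × G₂))
    (hM : ∀ q, q ∈ M ↔ ∀ p ∈ M, inner 𝕜 p.1 q.1 = inner 𝕜 p.2 q.2) :
    ∃ L : G₁ ≃ₗᵢ[𝕜] G₂, ∀ q, q ∈ M ↔ L q.1 = q.2 := by
  have hclosed : IsClosed (M : Set (G₁ × G₂)) := by
    have : (M : Set (G₁ × G₂)) =
        ⋂ p ∈ M, {q : G₁ × G₂ | inner 𝕜 p.1 q.1 = inner 𝕜 p.2 q.2} := by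
      ext q
      simp only [SetLike.mem_coe, Set.mem_iInter, Set.mem_ofPred_eq]
      exact hM q
    rw [this]
    exact isClosed_biInter fun p _ => isClosed_eq (by fun_prop) (by fun_prop)
  have : CompleteSpace M := hclosed.completeSpace_coe
  have hnorm : ∀ p : M, ‖(p : G₁ × G₂).1‖ = ‖(p : G₁ × G₂).2‖ := by
    intro p
    have h := (hM p).1 p.2 p p.2
    rw [inner_self_eq_norm_sq_to_K, inner_self_eq_norm_sq_to_K] at h
    have h' : ‖(p : G₁ × G₂).1‖ ^ 2 = ‖(p : G₁ × G₂).2‖ ^ 2 := by exact_mod_cast h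
    exact (pow_left_inj₀ (norm_nonneg _) (norm_nonneg _) two_ne_zero).1 h'
  -- The norm of the product is the maximum of the norms of the coordinates, which agree on `M`.
  let f₁ : M →ₗᵢ[𝕜] G₁ :=
    ⟨LinearMap.fst 𝕜 G₁ G₂ ∘ₗ M.subtype, fun p => by
      change ‖(p : G₁ × G₂).1‖ = ‖(p : G₁ × G₂)‖
      rw [Prod.norm_def, ← hnorm p, max_self]⟩
  let f₂ : M →ₗᵢ[𝕜] G₂ :=
    ⟨LinearMap.snd 𝕜 G₁ G₂ ∘ₗ M.subtype, fun p => by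
      change ‖(p : G₁ × G₂).2‖ = ‖(p : G₁ × G₂)‖
      rw [Prod.norm_def, hnorm p, max_self]⟩
  have hs₁ : Function.Surjective f₁ := by
    refine f₁.surjective_of_forall_inner_eq_zero fun g hg => ?_
    have hmem : ((g, 0) : G₁ × G₂) ∈ M := (hM _).2 fun p hp => by
      rw [inner_zero_right]
      exact hg ⟨p, hp⟩
    simpa using hnorm ⟨_, hmem⟩
  have hs₂ : Function.Surjective f₂ := by
    refine f₂.surjective_of_forall_inner_eq_zero fun g hg => ?_
    have hmem : ((0, g) : G₁ × G₂) ∈ M := (hM _).2 fun p hp => by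
      rw [inner_zero_right]
      exact (hg ⟨p, hp⟩).symm
    simpa using (hnorm ⟨_, hmem⟩).symm
  let e₁ := LinearIsometryEquiv.ofSurjective f₁ hs₁
  let e₂ := LinearIsometryEquiv.ofSurjective f₂ hs₂
  refine ⟨e₁.symm.trans e₂, fun q => ⟨fun hq => ?_, fun hq => ?_⟩⟩
  · have : e₁.symm q.1 = ⟨q, hq⟩ := (LinearIsometryEquiv.symm_apply_eq _).2 rfl
    rw [LinearIsometryEquiv.trans_apply, this]
    rfl
  · have h₁ : ((e₁.symm q.1 : M) : G₁ × G₂).1 = q.1 := e₁.apply_symm_apply q.1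
    have : ((e₁.symm q.1 : M) : G₁ × G₂) = q := Prod.ext h₁ hq
    exact this ▸ (e₁.symm q.1).2

/-! ### Skew-self-adjoint restrictions of `H₀†` -/

namespace BoundaryExtension

variable {𝕜 H G₁ G₂ : Type*} [RCLike 𝕜]
  [NormedAddCommGroup H] [InnerProductSpace 𝕜 H] [CompleteSpace H]
  [NormedAddCommGroup G₁] [InnerProductSpace 𝕜 G₁]
  [NormedAddCommGroup G₂] [InnerProductSpace 𝕜 G₂]
  {H₀ : H →ₗ.[𝕜] H}

theorem IsSkewSelfAdjoint.neg {T : H →ₗ.[𝕜] H} (h : IsSkewSelfAdjoint T) :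
    IsSkewSelfAdjoint (-T) :=
  ⟨h.1, by rw [LinearPMap.adjoint_neg h.1, ← h.2]⟩

theorem IsSkewSelfAdjoint.adjoint_eq {T : H →ₗ.[𝕜] H} (h : IsSkewSelfAdjoint T) : T† = -T :=
  (neg_eq_iff_eq_neg.2 h.2).symm

/-- Taking adjoints in `T ≤ H₀†` gives `H₀ ≤ H₀†† ≤ T† = -T`. -/
theorem IsSkewSelfAdjoint.neg_le_of_le_adjoint {T : H →ₗ.[𝕜] H}
    (hdense : Dense (H₀.domain : Set H)) (hT : T ≤ H₀†) (h : IsSkewSelfAdjoint T) : -H₀ ≤ T := by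
  have h₁ : H₀ ≤ H₀†† := LinearPMap.le_adjoint_adjoint hdense (h.1.mono hT.1)
  have h₂ : H₀†† ≤ -T := h.adjoint_eq ▸ LinearPMap.adjoint_le_adjoint_of_le h.1 hT
  simpa only [neg_neg] using LinearPMap.neg_le_neg_of_le (h₁.trans h₂)

/-- The domain of a skew-self-adjoint restriction of `H₀†` equals its own orthogonal complement for
the form `⟪H₀† x, y⟫ + ⟪x, H₀† y⟫` on the domain of `H₀†`, and conversely. -/
theorem isSkewSelfAdjoint_iff_of_le_adjoint {T : H →ₗ.[𝕜] H}
    (hdense : Dense (H₀.domain : Set H)) (hT : T ≤ H₀†) :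
    IsSkewSelfAdjoint T ↔ -H₀ ≤ T ∧ ∀ y : H₀†.domain, (y : H) ∈ T.domain ↔
      ∀ x : H₀†.domain, (x : H) ∈ T.domain →
        inner 𝕜 (H₀† x) (y : H) + inner 𝕜 (x : H) (H₀† y) = 0 := by
  constructor
  · intro h
    refine ⟨h.neg_le_of_le_adjoint hdense hT, fun y => ⟨fun hy x hx => ?_, fun hy => ?_⟩⟩
    · have hfa := LinearPMap.adjoint_isFormalAdjoint h.1
      rw [h.adjoint_eq] at hfa
      have := hfa ⟨x, hx⟩ ⟨y, hy⟩
      rw [LinearPMap.neg_apply, hT.2 (y := x) rfl, hT.2 (x := ⟨y, hy⟩) (y := y) rfl,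
        inner_neg_left] at this
      rw [← this, add_neg_cancel]
    · have hy' : (y : H) ∈ T†.domain := by
        refine LinearPMap.mem_adjoint_domain_of_exists _ ⟨-H₀† y, fun x => ?_⟩
        have h₁ := hy ⟨x, hT.1 x.2⟩ x.2
        rw [← hT.2 (x := x) rfl] at h₁
        rw [inner_neg_left, ← inner_conj_symm, ← inner_conj_symm (y : H), ← map_neg,
          ← eq_neg_of_add_eq_zero_left h₁]
      rw [h.adjoint_eq] at hy'
      exact hy'
  · rintro ⟨h₀, h⟩
    have hd : Dense (T.domain : Set H) := hdense.mono h₀.1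
    have h₁ : -T ≤ T† := by
      refine LinearPMap.IsFormalAdjoint.le_adjoint hd fun x (y : T.domain) => ?_
      have := (h ⟨y, hT.1 y.2⟩).1 y.2 ⟨x, hT.1 x.2⟩ x.2
      rw [← hT.2 (x := x) rfl, ← hT.2 (x := y) rfl] at this
      rw [LinearPMap.neg_apply, inner_neg_right]
      exact eq_neg_of_add_eq_zero_left this
    have h₂ : T† ≤ -H₀† := by
      rw [← LinearPMap.adjoint_neg hdense]
      exact LinearPMap.adjoint_le_adjoint_of_le (S := -H₀) hdense h₀
    have h₃ : T†.domain ≤ T.domain := by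
      intro y hy
      refine (h ⟨y, h₂.1 hy⟩).2 fun x hx => ?_
      have := (LinearPMap.adjoint_isFormalAdjoint hd).symm ⟨x, hx⟩ ⟨y, hy⟩
      rw [hT.2 (y := x) rfl, h₂.2 (x := ⟨y, hy⟩) (y := ⟨y, h₂.1 hy⟩) rfl, LinearPMap.neg_apply,
        inner_neg_right] at this
      rw [this]
      exact neg_add_cancel _
    refine ⟨hd, ?_⟩
    rw [← LinearPMap.eq_of_le_of_domain_eq h₁ (le_antisymm h₁.1 h₃), neg_neg]

/-! ### Boundary conditions `L F₁ x = F₂ x` -/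

theorem mem_schubertMap_domain {F₁ : H₀†.domain →ₗ[𝕜] G₁} {F₂ : H₀†.domain →ₗ[𝕜] G₂}
    {L : G₁ ≃ₗᵢ[𝕜] G₂} (x : H₀†.domain) :
    (x : H) ∈ (schubertMap F₁ F₂ L).domain ↔ L (F₁ x) = F₂ x :=
  ⟨fun h => h.1.2, fun h => ⟨⟨x.2, h⟩, x.2⟩⟩

theorem schubertMap_le {F₁ : H₀†.domain →ₗ[𝕜] G₁} {F₂ : H₀†.domain →ₗ[𝕜] G₂}
    {L : G₁ ≃ₗᵢ[𝕜] G₂} : schubertMap F₁ F₂ L ≤ H₀† :=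
  LinearPMap.domRestrict_le

theorem mem_gorbachukMap_domain {Γ₁ Γ₂ : H₀†.domain →ₗ[𝕜] G₁} {L : G₁ ≃ₗᵢ[𝕜] G₁}
    (x : H₀†.domain) : (x : H) ∈ (gorbachukMap Γ₁ Γ₂ L).domain ↔
      (L (Γ₁ x) - Γ₁ x) + (L (Γ₂ x) + Γ₂ x) = 0 :=
  ⟨fun h => h.1.2, fun h => ⟨⟨x.2, h⟩, x.2⟩⟩

theorem gorbachukMap_le {Γ₁ Γ₂ : H₀†.domain →ₗ[𝕜] G₁} {L : G₁ ≃ₗᵢ[𝕜] G₁} :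
    gorbachukMap Γ₁ Γ₂ L ≤ -H₀† :=
  LinearPMap.domRestrict_le

theorem schubertMap_injective {F₁ : H₀†.domain →ₗ[𝕜] G₁} {F₂ : H₀†.domain →ₗ[𝕜] G₂}
    (hsurj : Function.Surjective fun x => (F₁ x, F₂ x)) :
    Function.Injective fun L : G₁ ≃ₗᵢ[𝕜] G₂ => schubertMap F₁ F₂ L := by
  intro L L' h
  ext g
  obtain ⟨x, hx⟩ := hsurj (g, L g)
  obtain ⟨h₁, h₂⟩ := Prod.mk.inj hx
  have hx' : (x : H) ∈ (schubertMap F₁ F₂ L).domain := (mem_schubertMap_domain x).2 (by rw [h₁, h₂])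
  rw [show schubertMap F₁ F₂ L = schubertMap F₁ F₂ L' from h, mem_schubertMap_domain, h₁, h₂] at hx'
  exact hx'.symm

variable {F₁ : H₀†.domain →ₗ[𝕜] G₁} {F₂ : H₀†.domain →ₗ[𝕜] G₂}

/-- By surjectivity of `(F₁, F₂)` and nondegeneracy of the form on `G₁ × G₂`, both maps vanish on
the radical of the form on the domain of `H₀†`, which contains the domain of `H₀`. -/
theorem boundary_eq_zero_of_mem_domain (hdense : Dense (H₀.domain : Set H))
    (hskew : IsSkewSymmetric H₀) (hsurj : Function.Surjective fun x => (F₁ x, F₂ x))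
    (hgreen : ∀ x y : H₀†.domain, inner 𝕜 (H₀† x) (y : H) + inner 𝕜 (x : H) (H₀† y)
      = inner 𝕜 (F₁ x) (F₁ y) - inner 𝕜 (F₂ x) (F₂ y))
    (y : H₀†.domain) (hy : (y : H) ∈ H₀.domain) : F₁ y = 0 ∧ F₂ y = 0 := by
  have key : (F₁ y, F₂ y) = (0 : G₁ × G₂) := by
    refine standardUnitaryForm_separating (𝕜 := 𝕜) _ _ fun q => ?_
    obtain ⟨x, rfl⟩ := hsurj q
    have h₁ : inner 𝕜 (H₀† x) (y : H) = inner 𝕜 (x : H) (H₀ ⟨y, hy⟩) :=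
      LinearPMap.adjoint_isFormalAdjoint hdense x ⟨y, hy⟩
    have h₂ : H₀ ⟨y, hy⟩ = -H₀† y := hskew.2 (x := ⟨y, hy⟩) (y := y) rfl
    have h₃ := hgreen x y
    rw [h₁, h₂, inner_neg_right, neg_add_cancel] at h₃
    rw [_root_.map_zero]
    exact h₃.symm
  exact ⟨congrArg Prod.fst key, congrArg Prod.snd key⟩

theorem isSkewSelfAdjoint_schubertMap (hdense : Dense (H₀.domain : Set H))
    (hskew : IsSkewSymmetric H₀) (hsurj : Function.Surjective fun x => (F₁ x, F₂ x))
    (hgreen : ∀ x y : H₀†.domain, inner 𝕜 (H₀† x) (y : H) + inner 𝕜 (x : H) (H₀† y)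
      = inner 𝕜 (F₁ x) (F₁ y) - inner 𝕜 (F₂ x) (F₂ y)) (L : G₁ ≃ₗᵢ[𝕜] G₂) :
    IsSkewSelfAdjoint (schubertMap F₁ F₂ L) := by
  have hA : -H₀ ≤ H₀† := by
    simpa only [neg_neg] using LinearPMap.neg_le_neg_of_le hskew
  refine (isSkewSelfAdjoint_iff_of_le_adjoint hdense schubertMap_le).2 ⟨⟨?_, ?_⟩, fun y => ?_⟩
  · intro x hx
    refine (mem_schubertMap_domain ⟨x, hA.1 hx⟩).2 ?_
    obtain ⟨h₁, h₂⟩ := boundary_eq_zero_of_mem_domain hdense hskew hsurj hgreen ⟨x, hA.1 hx⟩ hx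
    rw [h₁, h₂, _root_.map_zero]
  · intro x y hxy
    rw [schubertMap_le.2 (x := y) (y := ⟨y, schubertMap_le.1 y.2⟩) rfl]
    exact hA.2 hxy
  · simp only [mem_schubertMap_domain, hgreen, sub_eq_zero]
    constructor
    · intro hy x hx
      rw [← hy, ← hx, L.inner_map_map]
    · intro h
      refine ext_inner_left 𝕜 fun v => ?_
      -- Test against a point whose boundary values are the point of the graph of `L` over `L⁻¹ v`.
      obtain ⟨x, hx⟩ := hsurj (L.symm v, v)
      obtain ⟨h₁, h₂⟩ := Prod.mk.inj hx
      have := h x (by rw [h₁, h₂, L.apply_symm_apply])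
      rw [h₁, h₂] at this
      rw [← this, ← L.inner_map_map, L.apply_symm_apply]

theorem exists_schubertMap_eq [CompleteSpace G₁] [CompleteSpace G₂]
    (hdense : Dense (H₀.domain : Set H))
    (hsurj : Function.Surjective fun x => (F₁ x, F₂ x))
    (hgreen : ∀ x y : H₀†.domain, inner 𝕜 (H₀† x) (y : H) + inner 𝕜 (x : H) (H₀† y)
      = inner 𝕜 (F₁ x) (F₁ y) - inner 𝕜 (F₂ x) (F₂ y))
    {T : H →ₗ.[𝕜] H} (hT : T ≤ H₀†) (h : IsSkewSelfAdjoint T) :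
    ∃ L : G₁ ≃ₗᵢ[𝕜] G₂, schubertMap F₁ F₂ L = T := by
  have hdom := ((isSkewSelfAdjoint_iff_of_le_adjoint hdense hT).1 h).2
  simp only [hgreen, sub_eq_zero] at hdom
  -- The subspace of boundary values attained on the domain of `T`.
  let M : Submodule 𝕜 (G₁ × G₂) := (T.domain.comap H₀†.domain.subtype).map (F₁.prod F₂)
  have hM : ∀ x : H₀†.domain, (F₁ x, F₂ x) ∈ M ↔ (x : H) ∈ T.domain := by
    refine fun x => ⟨?_, fun hx => ⟨x, hx, rfl⟩⟩
    rintro ⟨y, hy, hxy⟩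
    obtain ⟨h₁, h₂⟩ := Prod.mk.inj hxy
    -- Membership in the domain of `T` depends only on the boundary values.
    rw [hdom, ← h₁, ← h₂]
    exact (hdom y).1 hy
  obtain ⟨L, hL⟩ := exists_linearIsometryEquiv_of_forall_mem_iff M fun q => by
    obtain ⟨y, rfl⟩ := hsurj q
    rw [hM, hdom]
    constructor
    · rintro hy _ ⟨x, hx, rfl⟩
      exact hy x hx
    · exact fun hy x hx => hy (F₁ x, F₂ x) ((hM x).2 hx)
  refine ⟨L, LinearPMap.eq_of_le_of_forall_mem_domain_iff schubertMap_le hT fun x => ?_⟩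
  rw [mem_schubertMap_domain, ← hM, hL]

theorem bijOn_schubertMap [CompleteSpace G₁] [CompleteSpace G₂]
    (hdense : Dense (H₀.domain : Set H))
    (hskew : IsSkewSymmetric H₀) (hsurj : Function.Surjective fun x => (F₁ x, F₂ x))
    (hgreen : ∀ x y : H₀†.domain, inner 𝕜 (H₀† x) (y : H) + inner 𝕜 (x : H) (H₀† y)
      = inner 𝕜 (F₁ x) (F₁ y) - inner 𝕜 (F₂ x) (F₂ y)) :
    Set.BijOn (fun L : G₁ ≃ₗᵢ[𝕜] G₂ => schubertMap F₁ F₂ L) Set.univ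
      {T : H →ₗ.[𝕜] H | T ≤ H₀† ∧ IsSkewSelfAdjoint T} := by
  refine ⟨fun L _ => ⟨schubertMap_le, isSkewSelfAdjoint_schubertMap hdense hskew hsurj hgreen L⟩,
    (schubertMap_injective hsurj).injOn, ?_⟩
  rintro T ⟨hT, h⟩
  obtain ⟨L, hL⟩ := exists_schubertMap_eq hdense hsurj hgreen hT h
  exact ⟨L, Set.mem_univ L, hL⟩

/-- Negation exchanges the skew-self-adjoint extensions of `H₀` and the skew-self-adjoint
restrictions of `H₀†`. -/
theorem bijOn_neg_skewSelfAdjoint (hdense : Dense (H₀.domain : Set H)) :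
    Set.BijOn (fun T : H →ₗ.[𝕜] H => -T) {T | T ≤ H₀† ∧ IsSkewSelfAdjoint T}
      {T | H₀ ≤ T ∧ IsSkewSelfAdjoint T} := by
  refine ⟨?_, neg_injective.injOn, ?_⟩
  · rintro T ⟨hT, h⟩
    refine ⟨?_, h.neg⟩
    simpa only [neg_neg] using LinearPMap.neg_le_neg_of_le (h.neg_le_of_le_adjoint hdense hT)
  · rintro T ⟨hT, h⟩
    refine ⟨-T, ⟨?_, h.neg⟩, neg_neg T⟩
    rw [← h.adjoint_eq]
    exact LinearPMap.adjoint_le_adjoint_of_le hdense hT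

/-! ### From boundary systems to boundary triplets -/

theorem IsBoundarySystem.surjective_prod
    {F : H₀†.graph → G₁ × G₂}
    (hF : IsBoundarySystem H₀ (standardSymmetricForm 𝕜 H) F (standardUnitaryForm 𝕜 G₁ G₂)) :
    Function.Surjective fun x => (hF.F₁ x, hF.F₂ x) := by
  intro q
  obtain ⟨⟨p, hp⟩, rfl⟩ := hF.surjective q
  obtain ⟨x, h₁, h₂⟩ := (LinearPMap.mem_graph_iff _).1 hp
  refine ⟨x, ?_⟩
  have : graphPoint x = ⟨p, hp⟩ := Subtype.ext (Prod.ext h₁ h₂)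
  rw [← this]
  rfl

theorem IsBoundarySystem.green
    {F : H₀†.graph → G₁ × G₂}
    (hF : IsBoundarySystem H₀ (standardSymmetricForm 𝕜 H) F (standardUnitaryForm 𝕜 G₁ G₂))
    (x y : H₀†.domain) : inner 𝕜 (H₀† x) (y : H) + inner 𝕜 (x : H) (H₀† y)
      = inner 𝕜 (hF.F₁ x) (hF.F₁ y) - inner 𝕜 (hF.F₂ x) (hF.F₂ y) := by
  rw [add_comm]
  exact hF.form_eq (graphPoint x) (graphPoint y)

theorem sqrt_two_mul_sqrt_two : ((Real.sqrt 2 : ℝ) : 𝕜) * ((Real.sqrt 2 : ℝ) : 𝕜) = 2 := by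
  rw [← RCLike.ofReal_mul, Real.mul_self_sqrt zero_le_two, RCLike.ofReal_ofNat]

theorem sqrt_two_ne_zero : ((Real.sqrt 2 : ℝ) : 𝕜) ≠ 0 := by
  simp

theorem IsBoundarySystem.isBoundaryTriplet
    {F : H₀†.graph → G₁ × G₂}
    (hF : IsBoundarySystem H₀ (standardSymmetricForm 𝕜 H) F (standardUnitaryForm 𝕜 G₁ G₂))
    (L₀ : G₁ ≃ₗᵢ[𝕜] G₂) : IsBoundaryTriplet H₀ (hF.Γ₁ L₀) (hF.Γ₂ L₀) := by
  have hs := sqrt_two_mul_sqrt_two (𝕜 := 𝕜)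
  have hs0 := sqrt_two_ne_zero (𝕜 := 𝕜)
  have e₁ : ∀ x, hF.Γ₁ L₀ x = ((Real.sqrt 2 : ℝ) : 𝕜)⁻¹ • (hF.F₁ x + L₀.symm (hF.F₂ x)) :=
    fun _ => rfl
  have e₂ : ∀ x, hF.Γ₂ L₀ x = ((Real.sqrt 2 : ℝ) : 𝕜)⁻¹ • (hF.F₁ x - L₀.symm (hF.F₂ x)) :=
    fun _ => rfl
  constructor
  · rintro ⟨a, b⟩
    -- Solve `Γ₁ x = a`, `Γ₂ x = b` for the boundary values `F₁ x` and `F₂ x`.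
    obtain ⟨x, hx⟩ := hF.surjective_prod
      (((Real.sqrt 2 : ℝ) : 𝕜)⁻¹ • (a + b), L₀ (((Real.sqrt 2 : ℝ) : 𝕜)⁻¹ • (a - b)))
    obtain ⟨h₁, h₂⟩ := Prod.mk.inj hx
    have hc : ((Real.sqrt 2 : ℝ) : 𝕜)⁻¹ * ((Real.sqrt 2 : ℝ) : 𝕜)⁻¹ * 2 = 1 := by
      rw [← hs]; field_simp
    refine ⟨x, Prod.ext ?_ ?_⟩
    · change hF.Γ₁ L₀ x = a
      rw [e₁, h₁, h₂, L₀.symm_apply_apply, ← smul_add, smul_smul, add_add_sub_cancel, ← two_smul 𝕜,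
        smul_smul, hc, one_smul]
    · change hF.Γ₂ L₀ x = b
      rw [e₂, h₁, h₂, L₀.symm_apply_apply, ← smul_sub, smul_smul, add_sub_sub_cancel, ← two_smul 𝕜,
        smul_smul, hc, one_smul]
  · intro x y
    rw [hF.green, ← L₀.symm.inner_map_map (hF.F₂ x), e₁, e₁, e₂, e₂]
    simp only [inner_smul_left, inner_smul_right, inner_add_left, inner_add_right, inner_sub_left,
      inner_sub_right, map_inv₀, RCLike.conj_ofReal]
    field_simp
    rw [sq, hs]
    ring

/-- The expression `(L - 1) Γ₁ x + (L + 1) Γ₂ x` equals `L (Γ₁ x + Γ₂ x) - (Γ₁ x - Γ₂ x)`, that is,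
`√2 (L F₁ x - L₀⁻¹ F₂ x)`. -/
theorem IsBoundarySystem.mem_gorbachukMap_domain_iff
    {F : H₀†.graph → G₁ × G₂}
    (hF : IsBoundarySystem H₀ (standardSymmetricForm 𝕜 H) F (standardUnitaryForm 𝕜 G₁ G₂))
    (L₀ : G₁ ≃ₗᵢ[𝕜] G₂) (L : G₁ ≃ₗᵢ[𝕜] G₁) (x : H₀†.domain) :
    (x : H) ∈ (gorbachukMap (hF.Γ₁ L₀) (hF.Γ₂ L₀) L).domain ↔ L (hF.F₁ x) = L₀.symm (hF.F₂ x) := by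
  have e₁ : hF.Γ₁ L₀ x = ((Real.sqrt 2 : ℝ) : 𝕜)⁻¹ • (hF.F₁ x + L₀.symm (hF.F₂ x)) := rfl
  have e₂ : hF.Γ₂ L₀ x = ((Real.sqrt 2 : ℝ) : 𝕜)⁻¹ • (hF.F₁ x - L₀.symm (hF.F₂ x)) := rfl
  have h : (L (hF.Γ₁ L₀ x) - hF.Γ₁ L₀ x) + (L (hF.Γ₂ L₀ x) + hF.Γ₂ L₀ x)
      = (((Real.sqrt 2 : ℝ) : 𝕜)⁻¹ * 2) • (L (hF.F₁ x) - L₀.symm (hF.F₂ x)) := by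
    rw [e₁, e₂]
    simp only [_root_.map_smul, _root_.map_add, _root_.map_sub]
    module
  rw [mem_gorbachukMap_domain, h, smul_eq_zero_iff_right
    (mul_ne_zero (inv_ne_zero sqrt_two_ne_zero) two_ne_zero), sub_eq_zero]

theorem IsBoundarySystem.schubertMap_eq_neg_gorbachukMap
    {F : H₀†.graph → G₁ × G₂}
    (hF : IsBoundarySystem H₀ (standardSymmetricForm 𝕜 H) F (standardUnitaryForm 𝕜 G₁ G₂))
    (L₀ L : G₁ ≃ₗᵢ[𝕜] G₂) : schubertMap hF.F₁ hF.F₂ L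
      = -gorbachukMap (hF.Γ₁ L₀) (hF.Γ₂ L₀) (L.trans L₀.symm) := by
  refine LinearPMap.eq_of_le_of_forall_mem_domain_iff (A := H₀†) schubertMap_le ?_ fun x => ?_
  · simpa only [neg_neg] using LinearPMap.neg_le_neg_of_le gorbachukMap_le
  · rw [LinearPMap.neg_domain, hF.mem_gorbachukMap_domain_iff, mem_schubertMap_domain,
      LinearIsometryEquiv.trans_apply, L₀.symm.injective.eq_iff]

theorem IsBoundarySystem.bijOn_gorbachukMap [CompleteSpace G₁] [CompleteSpace G₂]
    (hdense : Dense (H₀.domain : Set H)) (hskew : IsSkewSymmetric H₀)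
    {F : H₀†.graph → G₁ × G₂}
    (hF : IsBoundarySystem H₀ (standardSymmetricForm 𝕜 H) F (standardUnitaryForm 𝕜 G₁ G₂))
    (L₀ : G₁ ≃ₗᵢ[𝕜] G₂) :
    Set.BijOn (fun L : G₁ ≃ₗᵢ[𝕜] G₁ => gorbachukMap (hF.Γ₁ L₀) (hF.Γ₂ L₀) L) Set.univ
      {T : H →ₗ.[𝕜] H | H₀ ≤ T ∧ IsSkewSelfAdjoint T} := by
  have htrans : Set.BijOn (fun L : G₁ ≃ₗᵢ[𝕜] G₁ => L.trans L₀) Set.univ Set.univ := by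
    refine Set.bijOn_univ.2 (Function.bijective_iff_has_inverse.2
      ⟨fun L => L.trans L₀.symm, fun L => ?_, fun L => ?_⟩) <;> ext <;> simp
  refine (((bijOn_neg_skewSelfAdjoint hdense).comp
    (bijOn_schubertMap hdense hskew hF.surjective_prod hF.green)).comp htrans).congr fun L _ => ?_
  have hL : (L.trans L₀).trans L₀.symm = L := by ext; simp
  simp only [Function.comp_apply]
  rw [hF.schubertMap_eq_neg_gorbachukMap L₀, hL, neg_neg]

end BoundaryExtension

theorem mainTheorem4 {𝕜 H G₁ G₂ : Type*} [RCLike 𝕜]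
    [NormedAddCommGroup H] [InnerProductSpace 𝕜 H] [CompleteSpace H]
    [NormedAddCommGroup G₁] [InnerProductSpace 𝕜 G₁] [CompleteSpace G₁]
    [NormedAddCommGroup G₂] [InnerProductSpace 𝕜 G₂] [CompleteSpace G₂]
    (H₀ : H →ₗ.[𝕜] H) (hdense : Dense (H₀.domain : Set H)) (hclosed : H₀.IsClosed)
    (hskew : BoundaryExtension.IsSkewSymmetric H₀)
    (F : H₀.adjoint.graph → G₁ × G₂)
    (hF : BoundaryExtension.IsBoundarySystem H₀
      (BoundaryExtension.standardSymmetricForm 𝕜 H) F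
      (BoundaryExtension.standardUnitaryForm 𝕜 G₁ G₂))
    (L₀ : G₁ ≃ₗᵢ[𝕜] G₂) :
    BoundaryExtension.IsBoundaryTriplet H₀ (hF.Γ₁ L₀) (hF.Γ₂ L₀) ∧
    Set.BijOn
      (fun L : G₁ ≃ₗᵢ[𝕜] G₁ => BoundaryExtension.gorbachukMap (hF.Γ₁ L₀) (hF.Γ₂ L₀) L)
      Set.univ {T : H →ₗ.[𝕜] H | H₀ ≤ T ∧ BoundaryExtension.IsSkewSelfAdjoint T} ∧
    Set.BijOn
      (fun L : G₁ ≃ₗᵢ[𝕜] G₂ => BoundaryExtension.schubertMap hF.F₁ hF.F₂ L)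
      Set.univ {T : H →ₗ.[𝕜] H | T ≤ H₀.adjoint ∧ BoundaryExtension.IsSkewSelfAdjoint T} ∧
    ∀ L : G₁ ≃ₗᵢ[𝕜] G₂,
      BoundaryExtension.schubertMap hF.F₁ hF.F₂ L
        = -BoundaryExtension.gorbachukMap (hF.Γ₁ L₀) (hF.Γ₂ L₀) (L.trans L₀.symm) :=
  ⟨hF.isBoundaryTriplet L₀, hF.bijOn_gorbachukMap hdense hskew L₀,
    BoundaryExtension.bijOn_schubertMap hdense hskew hF.surjective_prod hF.green,
    hF.schubertMap_eq_neg_gorbachukMap L₀⟩
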